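/- Let $\mathcal V$ be a variety of co-Heyting algebras, that is, the class of all models of some set of identities in the language $\{\mathbf 0,\mathbf 1,\vee,\wedge,-\}$ of co-Heyting algebras, where $a-b=\min\{c : a\le b\vee c\}$. The following are equivalent: 1. $\mathcal V$ has the finite model property: for every term $t(x)$ in finitely many variables $x$, if $\exists x\; t(x)\neq\mathbf 0$ holds in some algebra of $\mathcal V$, then it holds in some finite algebra of $\mathcal V$. 2. Every algebra free in $\mathcal V$ (on any set of generators) is residually finite. 3. Every algebra free in $\mathcal V$ (on any set of generators) is Hausdorff. 4. Every algebra finitely presented in $\mathcal V$ (that is, presented in $\mathcal V$ by finitely many generators and finitely many relations) is precompact and Hausdorff. Here, for a co-Heyting algebra $L$, write $a\bigtriangleup b=(a-b)\vee(b-a)$. For an ideal $I$ of $L$, $L/I$ is the quotient of $L$ by the congruence $a\bigtriangleup b\in I$. The algebra $L$ is *residually finite* if for every $a\neq\mathbf 0$ in $L$ there is an ideal $I$ with $a\notin I$ and $L/I$ finite. The height of a prime filter is its foundation rank (an ordinal, or $+\infty$) in the set of prime filters of $L$ ordered by inclusion, and $\operatorname{codim} a$ is the minimum of the heights of the prime filters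 containing $a$ ($+\infty$ if there are none). The algebra $L$ is *Hausdorff* if the topology of the pseudometric given by $d(a,b)=2^{-\operatorname{codim}(a\bigtriangleup b)}$ if $\operatorname{codim}(a\bigtriangleup b)<\omega$ and $d(a,b)=0$ otherwise is Hausdorff (equivalently, every nonzero element of $L$ has finite codimension). It is *precompact* if for every integer $d\ge 0$ the quotient $L/dL$ is finite, where $dL$ is the ideal $\{a\in L : \operatorname{codim} a\geq d\}$. -/

import Mathlib

universe u v

namespace CoHeyting

open Order

/-! ### Foundation rank, prime filter spectrum, codimension -/

open Classical in
/-- The foundation rank of `x` with respect to the strict order `<`, with value `⊤` (that is `+∞`)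
when there is no ordinal value: `rk x ≥ β + 1` iff there is `y < x` with `rk y ≥ β`, and
`rk x ≥ γ` for `γ` limit iff `rk x ≥ β` for all `β < γ`. -/
noncomputable def foundationRank {P : Type u} [Preorder P] (x : P) : WithTop Ordinal.{u} :=
  if h : Acc (fun y z : P => y < z) x then ((h.rank : Ordinal.{u}) : WithTop Ordinal.{u}) else ⊤

/-- The prime filter spectrum, ordered by inclusion. -/
abbrev PrimeFilterSpec (L : Type u) [Lattice L] [BoundedOrder L] : Type u :=
  {p : PFilter L // p.IsPrime}

/-- The codimension of `a`: the least height (foundation rank in the prime filter spectrum) of the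
prime filters containing `a`; it is `⊤` if there is no such prime filter. -/
noncomputable def codim {L : Type u} [Lattice L] [BoundedOrder L] (a : L) :
    WithTop Ordinal.{u} :=
  sInf {r | ∃ p : PrimeFilterSpec L, a ∈ p.1 ∧ r = foundationRank p}

section CodimLemmas

variable {L : Type u} [CoheytingAlgebra L]

theorem le_codim_iff {a : L} {r : WithTop Ordinal.{u}} :
    r ≤ codim a ↔ ∀ p : PrimeFilterSpec L, a ∈ p.1 → r ≤ foundationRank p := by
  unfold codim
  constructor
  · intro h p hp
    exact h.trans (sInf_le ⟨p, hp, rfl⟩)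
  · intro h
    refine le_sInf ?_
    rintro _ ⟨p, hp, rfl⟩
    exact h p hp

theorem codim_anti {a b : L} (h : a ≤ b) : codim b ≤ codim a :=
  le_codim_iff.2 fun p hp => le_codim_iff.1 le_rfl p (PFilter.mem_of_le h hp)

theorem bot_notMem (p : PrimeFilterSpec L) : (⊥ : L) ∉ p.1 := fun h => by
  obtain ⟨x, hx⟩ := p.2.compl_ideal.Nonempty
  exact hx (PFilter.mem_of_le bot_le h)

theorem codim_bot : codim (⊥ : L) = ⊤ :=
  top_le_iff.1 (le_codim_iff.2 fun p hp => absurd hp (bot_notMem p))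

theorem le_codim_sup {a b : L} {r : WithTop Ordinal.{u}} (ha : r ≤ codim a) (hb : r ≤ codim b) :
    r ≤ codim (a ⊔ b) := by
  refine le_codim_iff.2 fun p hp => ?_
  by_cases h1 : a ∈ p.1
  · exact le_codim_iff.1 ha p h1
  by_cases h2 : b ∈ p.1
  · exact le_codim_iff.1 hb p h2
  obtain ⟨z, hz, hza, hzb⟩ := p.2.compl_ideal.Directed a h1 b h2
  exact absurd (PFilter.mem_of_le (sup_le hza hzb) hp) hz

end CodimLemmas

/-! ### Ideals, quotients and the filtration by the codimension -/

/-- The congruence `a ≡ b ↔ a ∆ b ∈ I` of an ideal `I`; the underlying set of `L / I` is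
`Quotient (idealSetoid I)`. Here `symmDiff a b = a \ b ⊔ b \ a`. -/
def idealSetoid {L : Type u} [CoheytingAlgebra L] (I : Ideal L) : Setoid L where
  r a b := symmDiff a b ∈ I
  iseqv :=
    { refl := fun a => by rw [symmDiff_self]; exact I.bot_mem
      symm := fun {a b} h => by rw [symmDiff_comm]; exact h
      trans := fun {a b c} h h' => I.lower (symmDiff_triangle a b c) (Ideal.sup_mem h h') }

/-- The ideal `dL` of the elements of codimension at least `d`. -/
noncomputable def codimIdeal (L : Type u) [CoheytingAlgebra L] (d : ℕ) : Ideal L where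
  carrier := {a | ((d : Ordinal.{u}) : WithTop Ordinal.{u}) ≤ codim a}
  lower' := fun _ _ hba ha => le_trans (α := WithTop Ordinal.{u}) ha (codim_anti hba)
  nonempty' := ⟨⊥, by
    change ((d : Ordinal.{u}) : WithTop Ordinal.{u}) ≤ codim (⊥ : L)
    rw [codim_bot]; exact le_top⟩
  directed' := fun a ha b hb => ⟨a ⊔ b, le_codim_sup ha hb, le_sup_left, le_sup_right⟩

/-- Every `L / dL` with `d` finite is finite. -/
def IsPrecompact (L : Type u) [CoheytingAlgebra L] : Prop :=
  ∀ d : ℕ, Finite (Quotient (idealSetoid (codimIdeal L d)))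

/-- Every nonzero element is avoided by some ideal with a finite quotient. -/
def IsResiduallyFinite (L : Type u) [CoheytingAlgebra L] : Prop :=
  ∀ a : L, a ≠ ⊥ → ∃ I : Ideal L, a ∉ I ∧ Finite (Quotient (idealSetoid I))

/-! ### The codimetric pseudometric -/

/-- The codimension of `a` is finite. -/
def HasFiniteCodim {L : Type u} [CoheytingAlgebra L] (a : L) : Prop :=
  ∃ n : ℕ, codim a = ((n : Ordinal.{u}) : WithTop Ordinal.{u})

open Classical in
/-- `2 ^ (- codim (a ∆ b))` if this codimension is finite, and `0` otherwise. -/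
noncomputable def codist {L : Type u} [CoheytingAlgebra L] (a b : L) : ℝ :=
  if h : HasFiniteCodim (symmDiff a b) then ((2 : ℝ) ^ h.choose)⁻¹ else 0

section CodistLemmas

variable {L : Type u} [CoheytingAlgebra L]

theorem codist_eq {a b : L} {n : ℕ}
    (h : codim (symmDiff a b) = ((n : Ordinal.{u}) : WithTop Ordinal.{u})) :
    codist a b = ((2 : ℝ) ^ n)⁻¹ := by
  have h' : HasFiniteCodim (symmDiff a b) := ⟨n, h⟩
  have hn : h'.choose = n := by
    have := h'.choose_spec.symm.trans h
    exact_mod_cast this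
  rw [codist, dif_pos h', hn]

theorem codist_eq_zero {a b : L} (h : ¬ HasFiniteCodim (symmDiff a b)) : codist a b = 0 := by
  rw [codist, dif_neg h]

theorem codist_nonneg (a b : L) : 0 ≤ codist a b := by
  unfold codist
  split_ifs <;> positivity

theorem codist_comm (a b : L) : codist a b = codist b a := by
  by_cases h : HasFiniteCodim (symmDiff a b)
  · obtain ⟨n, hn⟩ := h
    rw [codist_eq hn, codist_eq (symmDiff_comm a b ▸ hn)]
  · rw [codist_eq_zero h, codist_eq_zero (symmDiff_comm a b ▸ h)]

theorem codist_self (a : L) : codist a a = 0 := by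
  refine codist_eq_zero ?_
  rintro ⟨n, hn⟩
  rw [symmDiff_self, codim_bot] at hn
  exact WithTop.top_ne_coe hn

theorem hasFiniteCodim_of_le {a : L} {n : ℕ}
    (h : codim a ≤ ((n : Ordinal.{u}) : WithTop Ordinal.{u})) :
    ∃ m : ℕ, m ≤ n ∧ codim a = ((m : Ordinal.{u}) : WithTop Ordinal.{u}) := by
  obtain ⟨o, ho, hon⟩ := WithTop.le_coe_iff.1 h
  obtain ⟨m, rfl⟩ := Ordinal.lt_omega0.1 (hon.trans_lt (Ordinal.natCast_lt_omega0 n))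
  exact ⟨m, by exact_mod_cast hon, ho⟩

theorem codist_triangle (a b c : L) : codist a c ≤ codist a b + codist b c := by
  by_cases h : HasFiniteCodim (symmDiff a c)
  · obtain ⟨n, hn⟩ := h
    have key : ∀ x y : L, codim (symmDiff x y) ≤ ((n : Ordinal.{u}) : WithTop Ordinal.{u}) →
        codist a c ≤ codist x y := by
      intro x y hxy
      obtain ⟨m, hmn, hm⟩ := hasFiniteCodim_of_le hxy
      rw [codist_eq hn, codist_eq hm]
      gcongr
      norm_num
    have h1 := codist_nonneg a b
    have h2 := codist_nonneg b c
    have h3 : codim (symmDiff a b ⊔ symmDiff b c) ≤ ((n : Ordinal.{u}) : WithTop Ordinal.{u}) :=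
      hn ▸ codim_anti (symmDiff_triangle a b c)
    rcases le_total (codim (symmDiff a b)) (codim (symmDiff b c)) with hle | hle
    · linarith [key a b ((le_codim_sup le_rfl hle).trans h3)]
    · linarith [key b c ((le_codim_sup hle le_rfl).trans h3)]
  · rw [codist_eq_zero h]
    exact add_nonneg (codist_nonneg a b) (codist_nonneg b c)

end CodistLemmas

/-- The pseudometric induced by the codimension. -/
@[reducible] noncomputable def codimetric (L : Type u) [CoheytingAlgebra L] :
    PseudoMetricSpace L where
  dist := codist
  dist_self := codist_self
  dist_comm := codist_comm
  dist_triangle := codist_triangle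

/-- The codimetric topology is Hausdorff. -/
def IsHausdorff (L : Type u) [CoheytingAlgebra L] : Prop :=
  @T2Space L (codimetric L).toUniformSpace.toTopologicalSpace

theorem isHausdorff_iff (L : Type u) [CoheytingAlgebra L] :
    IsHausdorff L ↔ ∀ a : L, a ≠ ⊥ → HasFiniteCodim a := by
  let _ := codimetric L
  constructor
  · intro h a ha
    have : T2Space L := h
    by_contra hc
    refine ha (Metric.inseparable_iff.2 ?_).eq
    change codist a ⊥ = 0
    refine codist_eq_zero ?_
    rwa [symmDiff_bot]
  · intro h
    have : T0Space L := ⟨fun a b hab => by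
      by_contra hne
      obtain ⟨n, hn⟩ := h (symmDiff a b) (by rwa [Ne, symmDiff_eq_bot])
      have h0 : codist a b = 0 := Metric.inseparable_iff.1 hab
      rw [codist_eq hn] at h0
      exact absurd h0 (by positivity)⟩
    change T2Space L
    infer_instance

/-! ### Terms, varieties, free and finitely presented algebras -/

/-- Terms in the language `{0, 1, ∨, ∧, -}` of co-Heyting algebras. -/
inductive Term (X : Type v) : Type v
  | var : X → Term X
  | zero : Term X
  | one : Term X
  | sup : Term X → Term X → Term X
  | inf : Term X → Term X → Term X
  | sub : Term X → Term X → Term X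

/-- The value of a term at an assignment of its variables. -/
def Term.eval {X : Type v} {L : Type u} [CoheytingAlgebra L] (a : X → L) : Term X → L
  | var x => a x
  | zero => ⊥
  | one => ⊤
  | sup s t => s.eval a ⊔ t.eval a
  | inf s t => s.eval a ⊓ t.eval a
  | sub s t => s.eval a \ t.eval a

/-- A class of co-Heyting algebras (in a fixed universe). -/
abbrev AlgebraClass : Type (u + 1) := ∀ (L : Type u) [CoheytingAlgebra L], Prop

/-- A variety of co-Heyting algebras: the class of the models of some set of identities. -/
def IsVariety (V : AlgebraClass.{u}) : Prop :=
  ∃ E : Set (Term ℕ × Term ℕ), ∀ (L : Type u) [CoheytingAlgebra L],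
    V L ↔ ∀ e ∈ E, ∀ a : ℕ → L, e.1.eval a = e.2.eval a

/-- Every term which is not identically zero on some algebra in `V` is not identically zero on
some finite algebra in `V`. -/
def HasFiniteModelProperty (V : AlgebraClass.{u}) : Prop :=
  ∀ t : Term ℕ,
    (∃ (L : Type u) (_ : CoheytingAlgebra L), V L ∧ ∃ a : ℕ → L, t.eval a ≠ ⊥) →
    ∃ (L : Type u) (_ : CoheytingAlgebra L), V L ∧ Finite L ∧ ∃ a : ℕ → L, t.eval a ≠ ⊥

/-- `L` is presented in `V` by the generators `g` and the relations `R`. -/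
structure IsPresentedBy (V : AlgebraClass.{u}) {X : Type v} (R : Set (Term X × Term X))
    (L : Type u) [CoheytingAlgebra L] (g : X → L) : Prop where
  mem : V L
  rel : ∀ e ∈ R, e.1.eval g = e.2.eval g
  universal : ∀ (A : Type u) [CoheytingAlgebra A], V A → ∀ f : X → A,
    (∀ e ∈ R, e.1.eval f = e.2.eval f) → ∃! φ : CoheytingHom L A, ∀ x, φ (g x) = f x

/-- `L` is free in `V` on some family `g` of generators (a presentation without relations): every
map from the generators to an algebra in `V` extends uniquely to a morphism. -/
def IsFreeIn (V : AlgebraClass.{u}) (L : Type u) [CoheytingAlgebra L] : Prop :=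
  ∃ (X : Type u) (g : X → L), IsPresentedBy V ∅ L g

/-- `L` has in `V` a presentation by finitely many generators and finitely many relations. -/
def IsFinitelyPresentedIn (V : AlgebraClass.{u}) (L : Type u) [CoheytingAlgebra L] : Prop :=
  ∃ (n : ℕ) (R : Set (Term (Fin n) × Term (Fin n))) (g : Fin n → L),
    R.Finite ∧ IsPresentedBy V R L g

end CoHeyting

/-!
The proof rests on two finiteness facts about the prime filter spectrum.

* If `L` is generated by finitely many elements, then for each `d : ℕ` there are only finitely many
  prime filters of height less than `d` (`finite_setOf_foundationRank_lt`): whether `t(g)` belongs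
  to a prime filter `p` is determined by the generators in `p` and by the prime filters strictly
  below `p`, since `a \ b ∈ p` iff some prime filter `q ≤ p` contains `a` and not `b`
  (`sdiff_mem_iff`). An element of `L` is determined modulo `dL` by the prime filters of height
  less than `d` containing it, so finitely generated algebras are precompact.
* If `L / I` is finite and `a ∉ I`, then some prime filter containing `a` is disjoint from `I`.
  Prime filters disjoint from `I` are unions of classes modulo `I`, so there are finitely many of
  them, and they form an initial segment of the spectrum. Hence `a` has finite codimension
  (`IsResiduallyFinite.isHausdorff`).

The finite model property gives residual finiteness of every algebra `L` with finitely many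
relations, on any set of generators (`isResiduallyFinite_of_isPresentedBy`): merge the relations
into one, `r = 0`, with `r(g) = 0`. If `t(g) ≠ 0` in `L`, then `t(g) - r(g) ≠ 0`, so `t - r` does
not vanish on some finite `A` in the variety; dividing `A` by the ideal generated by the value of
`r` makes the relations hold without killing `t`, and `L` maps to this finite quotient.

Conversely, if the free algebra `F` on `n` generators is Hausdorff, a term in `n` variables that
does not vanish identically on the variety has finite codimension at the generators of `F`, so it
survives in some `F / dF`, which is finite by precompactness (`hasFiniteModelProperty_of_free`).
-/

namespace CoHeyting

open Order

/-! ### Prime filters -/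

section PrimeFilters

variable {L : Type u} [CoheytingAlgebra L]

/-- Prime separation: the distributive lattice structure yields, from an ideal `J` that does not
contain `a`, a prime filter containing `a` and disjoint from `J`. -/
theorem exists_primeFilter {J : Ideal L} {a : L} (h : a ∉ J) :
    ∃ p : PrimeFilterSpec L, a ∈ p.1 ∧ ∀ x ∈ J, x ∉ p.1 := by
  have hd : Disjoint (PFilter.principal a : Set L) (J : Set L) :=
    Set.disjoint_left.2 fun x hx hxJ => h (J.lower (PFilter.mem_principal.1 hx) hxJ)
  obtain ⟨K, hK, hJK, hdK⟩ := DistribLattice.prime_ideal_of_disjoint_filter_ideal hd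
  have hmem : ∀ x, x ∈ hK.toPrimePair.F ↔ x ∉ K := fun x => Iff.rfl
  refine ⟨⟨hK.toPrimePair.F, hK.toPrimePair.F_isPrime⟩, ?_, fun x hx hxp => ?_⟩
  · exact (hmem a).2 fun haK => Set.disjoint_left.1 hdK (PFilter.mem_principal.2 le_rfl) haK
  · exact (hmem x).1 hxp (hJK hx)

theorem sup_mem_iff (p : PrimeFilterSpec L) {a b : L} : a ⊔ b ∈ p.1 ↔ a ∈ p.1 ∨ b ∈ p.1 := by
  constructor
  · intro h
    by_contra! hc
    obtain ⟨z, hz, hza, hzb⟩ := p.2.compl_ideal.Directed a hc.1 b hc.2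
    exact hz (PFilter.mem_of_le (sup_le hza hzb) h)
  · rintro (h | h)
    · exact PFilter.mem_of_le le_sup_left h
    · exact PFilter.mem_of_le le_sup_right h

theorem top_mem_primeFilter (p : PrimeFilterSpec L) : (⊤ : L) ∈ p.1 := by
  obtain ⟨x, hx⟩ := p.1.nonempty
  exact PFilter.mem_of_le le_top hx

/-- The prime filter below `p` containing `a` and not `b` is obtained by separating `a` from the
ideal generated by `b` and the complement of `p`. -/
theorem sdiff_mem_iff (p : PrimeFilterSpec L) {a b : L} :
    a \ b ∈ p.1 ↔ ∃ q ≤ p, a ∈ q.1 ∧ b ∉ q.1 := by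
  constructor
  · intro h
    have ha : a ∉ p.2.compl_ideal.toIdeal ⊔ Ideal.principal b := by
      rw [Lattice.mem_ideal_sup_principal]
      rintro ⟨z, hz, hab⟩
      refine (show z ∉ p.1 from hz) (PFilter.mem_of_le ?_ h)
      rwa [sdiff_le_iff, sup_comm]
    obtain ⟨q, haq, hq⟩ := exists_primeFilter ha
    refine ⟨q, ?_, haq, ?_⟩
    · intro x hxq
      by_contra hxp
      exact hq x (Ideal.mem_sup.2 ⟨x, hxp, b, Ideal.mem_principal.2 le_rfl, le_sup_left⟩) hxq
    · exact hq b (Lattice.mem_ideal_sup_principal b b _ |>.2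
        ⟨⊥, bot_notMem p, le_sup_right⟩)
  · rintro ⟨q, hqp, ha, hb⟩
    exact hqp (((sup_mem_iff q).1 (PFilter.mem_of_le le_sup_sdiff ha)).resolve_left hb)

theorem primeFilter_ext {p q : PrimeFilterSpec L} (h : ∀ a, a ∈ p.1 ↔ a ∈ q.1) : p = q :=
  Subtype.ext (SetLike.ext h)

end PrimeFilters

/-! ### Finite foundation ranks -/

section FoundationRank

variable {P : Type u} [Preorder P]

theorem foundationRank_lt_of_lt {x y : P} {k : ℕ} (hyx : y < x)
    (hx : foundationRank x < (((k + 1 : ℕ) : Ordinal.{u}) : WithTop Ordinal.{u})) :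
    foundationRank y < ((k : Ordinal.{u}) : WithTop Ordinal.{u}) := by
  unfold foundationRank at hx ⊢
  by_cases hacc : Acc (fun y z : P => y < z) x
  · rw [dif_pos hacc, WithTop.coe_lt_coe] at hx
    rw [dif_pos (hacc.inv hyx), WithTop.coe_lt_coe]
    rw [Nat.cast_succ, Order.lt_add_one_iff] at hx
    exact (hacc.rank_lt_of_rel hyx).trans_le hx
  · rw [dif_neg hacc] at hx
    exact absurd hx not_top_lt

theorem exists_foundationRank_le_natCast {x : P} (hfin : {y | y < x}.Finite) :
    ∃ n : ℕ, foundationRank x ≤ ((n : Ordinal.{u}) : WithTop Ordinal.{u}) := by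
  suffices H : ∀ (n : ℕ) (x : P), {y | y < x}.Finite → {y | y < x}.ncard ≤ n →
      ∃ h : Acc (fun y z : P => y < z) x, h.rank ≤ (n : Ordinal.{u}) by
    obtain ⟨h, hle⟩ := H _ x hfin le_rfl
    refine ⟨{y | y < x}.ncard, ?_⟩
    rw [foundationRank, dif_pos h]
    exact WithTop.coe_le_coe.2 hle
  intro n
  induction n with
  | zero =>
    intro x hf hc
    have hempty : {y | y < x} = ∅ := (Set.ncard_eq_zero hf).1 (Nat.le_zero.1 hc)
    have hx : ∀ y, ¬ y < x := fun y hy => (Set.ext_iff.1 hempty y).1 hy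
    refine ⟨⟨_, fun y hy => absurd hy (hx y)⟩, ?_⟩
    rw [Acc.rank_eq]
    exact Ordinal.iSup_le fun b => absurd b.2 (hx b)
  | succ n ih =>
    intro x hf hc
    have key : ∀ y, y < x → ∃ h : Acc (fun y z : P => y < z) y, h.rank ≤ (n : Ordinal.{u}) := by
      intro y hy
      have hss : {z | z < y} ⊂ {z | z < x} :=
        ⟨fun z hz => lt_trans hz hy, fun h => lt_irrefl y (h hy)⟩
      have := Set.ncard_lt_ncard hss hf
      exact ih y (hf.subset hss.1) (by omega)
    refine ⟨⟨_, fun y hy => (key y hy).1⟩, ?_⟩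
    rw [Acc.rank_eq]
    refine Ordinal.iSup_le fun b => ?_
    rw [Nat.cast_succ, ← Order.succ_eq_add_one]
    exact Order.succ_le_succ (key b b.2).2

end FoundationRank

/-! ### Residually finite algebras are Hausdorff -/

theorem mem_primeFilter_of_symmDiff_mem {L : Type u} [CoheytingAlgebra L] {I : Ideal L}
    {p : PrimeFilterSpec L} (hp : ∀ x ∈ I, x ∉ p.1) {a b : L} (h : symmDiff a b ∈ I)
    (ha : a ∈ p.1) : b ∈ p.1 := by
  have hab : a \ b ∉ p.1 := hp _ (I.lower le_sup_left h)
  exact ((sup_mem_iff p).1 (PFilter.mem_of_le le_sup_sdiff ha)).resolve_right hab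

theorem IsResiduallyFinite.isHausdorff {L : Type u} [CoheytingAlgebra L]
    (h : IsResiduallyFinite L) : IsHausdorff L := by
  rw [isHausdorff_iff]
  intro a ha
  obtain ⟨I, haI, hfin⟩ := h a ha
  obtain ⟨p, hap, hp⟩ := exists_primeFilter haI
  -- A prime filter disjoint from `I` is the preimage of a subset of the finite quotient.
  have hinj : Set.InjOn (fun (q : PrimeFilterSpec L) =>
      {c : Quotient (idealSetoid I) | ∃ x ∈ q.1, Quotient.mk _ x = c})
      {q | ∀ x ∈ I, x ∉ q.1} := by
    intro q hq q' hq' heq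
    have aux : ∀ {r r' : PrimeFilterSpec L}, (∀ x ∈ I, x ∉ r'.1) →
        {c : Quotient (idealSetoid I) | ∃ x ∈ r.1, Quotient.mk _ x = c} =
          {c | ∃ x ∈ r'.1, Quotient.mk _ x = c} → ∀ y ∈ r.1, y ∈ r'.1 := by
      intro r r' hr' hrr y hy
      obtain ⟨x, hx, hxy⟩ := (Set.ext_iff.1 hrr (Quotient.mk _ y)).1 ⟨y, hy, rfl⟩
      exact mem_primeFilter_of_symmDiff_mem hr' (Quotient.exact hxy) hx
    exact primeFilter_ext fun y => ⟨aux hq' heq y, aux hq heq.symm y⟩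
  have hset : {q : PrimeFilterSpec L | ∀ x ∈ I, x ∉ q.1}.Finite :=
    Set.Finite.of_finite_image (Set.toFinite _) hinj
  obtain ⟨n, hn⟩ := exists_foundationRank_le_natCast (x := p)
    (hset.subset fun q hq x hx hxq => hp x hx (hq.le hxq))
  obtain ⟨m, -, hm⟩ := hasFiniteCodim_of_le ((le_codim_iff.1 le_rfl p hap).trans hn)
  exact ⟨m, hm⟩

/-! ### Finitely generated algebras are precompact -/

/-- Every element of `L` is the value at `g` of a term. -/
def IsGeneratedBy {X : Type v} {L : Type u} [CoheytingAlgebra L] (g : X → L) : Prop :=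
  ∀ a : L, ∃ t : Term X, t.eval g = a

section Precompact

variable {X : Type v} {L : Type u} [CoheytingAlgebra L] {g : X → L}

theorem eval_mem_iff_of_lt_iff {p p' : PrimeFilterSpec L} (hg : ∀ x, g x ∈ p.1 ↔ g x ∈ p'.1)
    (hlt : ∀ q, q < p ↔ q < p') (t : Term X) : t.eval g ∈ p.1 ↔ t.eval g ∈ p'.1 := by
  induction t with
  | var x => exact hg x
  | zero => exact iff_of_false (bot_notMem p) (bot_notMem p')
  | one => exact iff_of_true (top_mem_primeFilter p) (top_mem_primeFilter p')
  | sup s t hs ht => exact (sup_mem_iff p).trans ((or_congr hs ht).trans (sup_mem_iff p').symm)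
  | inf s t hs ht =>
    exact PFilter.inf_mem_iff.trans ((and_congr hs ht).trans PFilter.inf_mem_iff.symm)
  | sub s t hs ht =>
    simp only [Term.eval, sdiff_mem_iff, le_iff_lt_or_eq, or_and_right, exists_or,
      exists_eq_left, hlt, hs, ht]

theorem finite_setOf_foundationRank_lt [Finite X] (hgen : IsGeneratedBy g) (d : ℕ) :
    {p : PrimeFilterSpec L |
      foundationRank p < ((d : Ordinal.{u}) : WithTop Ordinal.{u})}.Finite := by
  induction d with
  | zero =>
    convert Set.finite_empty (α := PrimeFilterSpec L)
    refine Set.eq_empty_of_forall_notMem fun p hp => ?_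
    obtain ⟨o, ho, ho'⟩ := WithTop.lt_iff_exists_coe.1 hp
    rw [Set.mem_ofPred_eq, ho, WithTop.coe_lt_coe, Nat.cast_zero] at hp
    exact not_lt_bot hp
  | succ k ih =>
    refine Set.Finite.of_finite_image (f := fun p : PrimeFilterSpec L =>
      ({x | g x ∈ p.1}, {q | q < p})) ?_ ?_
    · refine (Set.finite_univ.prod ih.finite_subsets).subset ?_
      rintro _ ⟨p, hp, rfl⟩
      exact ⟨trivial, fun q hq => foundationRank_lt_of_lt hq hp⟩
    · intro p _ p' _ heq
      obtain ⟨h1, h2⟩ := Prod.mk.inj heq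
      refine primeFilter_ext fun a => ?_
      obtain ⟨t, rfl⟩ := hgen a
      have hg := fun x => Set.ext_iff.1 h1 x
      have hlt := fun q => Set.ext_iff.1 h2 q
      exact eval_mem_iff_of_lt_iff hg hlt t

theorem IsGeneratedBy.isPrecompact [Finite X] (hgen : IsGeneratedBy g) : IsPrecompact L := by
  intro d
  let S := {p : PrimeFilterSpec L | foundationRank p < ((d : Ordinal.{u}) : WithTop Ordinal.{u})}
  have hS : S.Finite := finite_setOf_foundationRank_lt hgen d
  have hsub : ∀ {a b : L}, S ∩ {p | a ∈ p.1} ⊆ {p | b ∈ p.1} → a \ b ∈ codimIdeal L d := by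
    intro a b h
    refine le_codim_iff.2 fun p hp => not_lt.1 fun hlt => ?_
    obtain ⟨q, hqp, ha, hb⟩ := (sdiff_mem_iff p).1 hp
    have hq : q ∈ S := by
      rcases hqp.lt_or_eq with hlt' | rfl
      · refine foundationRank_lt_of_lt hlt' (hlt.trans ?_)
        exact_mod_cast Nat.lt_succ_self d
      · exact hlt
    exact hb (h ⟨hq, ha⟩)
  have : Finite {T // T ⊆ S} := hS.finite_subsets.to_subtype
  refine Finite.of_injective (β := {T // T ⊆ S})
    (Quotient.lift (fun a => ⟨S ∩ {p | a ∈ p.1}, Set.inter_subset_left⟩) ?_) ?_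
  · have aux : ∀ {a b : L}, symmDiff a b ∈ codimIdeal L d →
        S ∩ {p | a ∈ p.1} ⊆ S ∩ {p | b ∈ p.1} := by
      rintro a b hab p ⟨hpS, hap⟩
      refine ⟨hpS, mem_primeFilter_of_symmDiff_mem (fun x hx hxp => ?_) hab hap⟩
      exact not_lt.2 (le_codim_iff.1 hx p hxp) hpS
    intro a b hab
    exact Subtype.ext (Set.Subset.antisymm (aux hab) (aux (by rw [symmDiff_comm]; exact hab)))
  · rintro ⟨a⟩ ⟨b⟩ hab
    have heq : S ∩ {p | a ∈ p.1} = S ∩ {p | b ∈ p.1} := Subtype.ext_iff.1 hab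
    exact Quotient.sound (Ideal.sup_mem
      (hsub (heq.subset.trans Set.inter_subset_right))
      (hsub (heq.superset.trans Set.inter_subset_right)))

end Precompact

/-! ### Terms -/

/-- The simultaneous substitution of terms for the variables of a term. -/
def Term.subst {X Y : Type*} (σ : X → Term Y) : Term X → Term Y
  | var x => σ x
  | zero => zero
  | one => one
  | sup s t => sup (s.subst σ) (t.subst σ)
  | inf s t => inf (s.subst σ) (t.subst σ)
  | sub s t => sub (s.subst σ) (t.subst σ)

/-- The set of the variables occurring in a term. -/
def Term.vars {X : Type*} : Term X → Set X
  | var x => {x}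
  | zero => ∅
  | one => ∅
  | sup s t => s.vars ∪ t.vars
  | inf s t => s.vars ∪ t.vars
  | sub s t => s.vars ∪ t.vars

namespace Term

variable {X : Type*} {Y : Type*} {L : Type*} [CoheytingAlgebra L]

theorem finite_vars (t : Term X) : t.vars.Finite := by
  induction t with
  | var x => exact Set.finite_singleton x
  | zero => exact Set.finite_empty
  | one => exact Set.finite_empty
  | sup s t hs ht => exact hs.union ht
  | inf s t hs ht => exact hs.union ht
  | sub s t hs ht => exact hs.union ht

theorem eval_subst (σ : X → Term Y) (f : Y → L) (t : Term X) :
    (t.subst σ).eval f = t.eval fun x => (σ x).eval f := by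
  induction t <;> simp_all [subst, eval]

theorem eval_congr {f f' : X → L} {t : Term X} (h : ∀ x ∈ t.vars, f x = f' x) :
    t.eval f = t.eval f' := by
  induction t with
  | var x => exact h x rfl
  | zero => rfl
  | one => rfl
  | sup s t hs ht =>
    exact congrArg₂ (· ⊔ ·) (hs fun x hx => h x (.inl hx)) (ht fun x hx => h x (.inr hx))
  | inf s t hs ht =>
    exact congrArg₂ (· ⊓ ·) (hs fun x hx => h x (.inl hx)) (ht fun x hx => h x (.inr hx))
  | sub s t hs ht =>
    exact congrArg₂ (· \ ·) (hs fun x hx => h x (.inl hx)) (ht fun x hx => h x (.inr hx))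

theorem map_eval {M : Type*} [CoheytingAlgebra M] (φ : CoheytingHom L M) (f : X → L)
    (t : Term X) : φ (t.eval f) = t.eval fun x => φ (f x) := by
  induction t <;> simp_all [eval]

/-- A family of values of the variables of `t` can be transported along a numbering `ρ` that is
injective on these variables. -/
theorem exists_eval_subst_var_eq {t : Term X} {ρ : X → ℕ} (hρ : Set.InjOn ρ t.vars) (f : X → L) :
    ∃ y : ℕ → L, (t.subst fun x => var (ρ x)).eval y = t.eval f := by
  classical
  refine ⟨fun n => if h : ∃ x ∈ t.vars, ρ x = n then f h.choose else ⊥, ?_⟩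
  rw [eval_subst]
  refine eval_congr fun x hx => ?_
  have h : ∃ x' ∈ t.vars, ρ x' = ρ x := ⟨x, hx, rfl⟩
  rw [eval, dif_pos h, hρ h.choose_spec.1 hx h.choose_spec.2]

/-- Finitely many equations can be replaced by a single equation `r = 0` up to division by the
ideal generated by the value of `r`. -/
theorem exists_of_finite_relations {R : Set (Term X × Term X)} (hR : R.Finite) :
    ∃ r : Term X, ∀ (A : Type u) [CoheytingAlgebra A] (f : X → A),
      ((∀ e ∈ R, e.1.eval f = e.2.eval f) → r.eval f = ⊥) ∧
      ∀ e ∈ R, symmDiff (e.1.eval f) (e.2.eval f) ≤ r.eval f := by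
  induction R, hR using Set.Finite.induction_on with
  | empty => exact ⟨zero, fun A _ f => ⟨fun _ => rfl, fun e he => he.elim⟩⟩
  | @insert e R _ _ ih =>
    obtain ⟨r, hr⟩ := ih
    refine ⟨sup (sup (sub e.1 e.2) (sub e.2 e.1)) r, fun A _ f => ⟨fun h => ?_, ?_⟩⟩
    · have h1 := h e (Set.mem_insert _ _)
      have h2 := (hr A f).1 fun e' he' => h e' (Set.mem_insert_of_mem _ he')
      simp [eval, h1, h2]
    · rintro e' (rfl | he')
      · exact le_sup_left
      · exact ((hr A f).2 e' he').trans le_sup_right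

end Term

/-! ### Quotients by compatible preorders -/

/-- Operations on `α` that satisfy the universal properties of the operations of a co-Heyting
algebra for a preorder. The quotient of `α` by the equivalence of this preorder is a co-Heyting
algebra, the operations being compatible with the equivalence by their universal properties. -/
structure PreCoheyting (α : Type u) where
  /-- The preorder. -/
  le : α → α → Prop
  /-- The join. -/
  sup : α → α → α
  /-- The meet. -/
  inf : α → α → α
  /-- The difference. -/
  sdiff : α → α → α
  /-- The least element. -/
  bot : α
  /-- The greatest element. -/
  top : α
  refl : ∀ a, le a a
  trans : ∀ {a b c}, le a b → le b c → le a c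
  le_sup_left : ∀ a b, le a (sup a b)
  le_sup_right : ∀ a b, le b (sup a b)
  sup_le : ∀ {a b c}, le a c → le b c → le (sup a b) c
  inf_le_left : ∀ a b, le (inf a b) a
  inf_le_right : ∀ a b, le (inf a b) b
  le_inf : ∀ {a b c}, le a b → le a c → le a (inf b c)
  bot_le : ∀ a, le bot a
  le_top : ∀ a, le a top
  sdiff_le_iff : ∀ a b c, le (sdiff a b) c ↔ le a (sup b c)

namespace PreCoheyting

variable {α : Type u} (P : PreCoheyting α)

/-- The equivalence relation of the preorder. -/
def setoid : Setoid α where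
  r a b := P.le a b ∧ P.le b a
  iseqv := ⟨fun a => ⟨P.refl a, P.refl a⟩, fun h => ⟨h.2, h.1⟩,
    fun h h' => ⟨P.trans h.1 h'.1, P.trans h'.2 h.2⟩⟩

theorem sup_mono {a a' b b' : α} (h : P.le a a') (h' : P.le b b') :
    P.le (P.sup a b) (P.sup a' b') :=
  P.sup_le (P.trans h (P.le_sup_left _ _)) (P.trans h' (P.le_sup_right _ _))

theorem inf_mono {a a' b b' : α} (h : P.le a a') (h' : P.le b b') :
    P.le (P.inf a b) (P.inf a' b') :=
  P.le_inf (P.trans (P.inf_le_left _ _) h) (P.trans (P.inf_le_right _ _) h')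

theorem sdiff_mono {a a' b b' : α} (h : P.le a a') (h' : P.le b' b) :
    P.le (P.sdiff a b) (P.sdiff a' b') :=
  (P.sdiff_le_iff _ _ _).2 <| P.trans h <|
    P.trans ((P.sdiff_le_iff _ _ _).1 (P.refl (P.sdiff a' b'))) (P.sup_mono h' (P.refl _))

/-- The quotient by the equivalence relation of the preorder. -/
def Carrier : Type u := Quotient P.setoid

/-- The class of an element. -/
def toCarrier (a : α) : P.Carrier := Quotient.mk P.setoid a

theorem toCarrier_surjective : Function.Surjective P.toCarrier := Quotient.mk_surjective

instance : CoheytingAlgebra P.Carrier where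
  le := Quotient.lift₂ (s₁ := P.setoid) (s₂ := P.setoid) P.le fun _ _ _ _ h h' =>
    propext ⟨fun hab => P.trans h.2 (P.trans hab h'.1), fun hab => P.trans h.1 (P.trans hab h'.2)⟩
  le_refl := by rintro ⟨a⟩; exact P.refl a
  le_trans := by rintro ⟨a⟩ ⟨b⟩ ⟨c⟩ h h'; exact P.trans h h'
  le_antisymm := by rintro ⟨a⟩ ⟨b⟩ h h'; exact Quotient.sound ⟨h, h'⟩
  sup := Quotient.map₂ P.sup fun _ _ h _ _ h' => ⟨P.sup_mono h.1 h'.1, P.sup_mono h.2 h'.2⟩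
  inf := Quotient.map₂ P.inf fun _ _ h _ _ h' => ⟨P.inf_mono h.1 h'.1, P.inf_mono h.2 h'.2⟩
  sdiff := Quotient.map₂ P.sdiff fun _ _ h _ _ h' =>
    ⟨P.sdiff_mono h.1 h'.2, P.sdiff_mono h.2 h'.1⟩
  le_sup_left := by rintro ⟨a⟩ ⟨b⟩; exact P.le_sup_left a b
  le_sup_right := by rintro ⟨a⟩ ⟨b⟩; exact P.le_sup_right a b
  sup_le := by rintro ⟨a⟩ ⟨b⟩ ⟨c⟩ h h'; exact P.sup_le h h'
  inf_le_left := by rintro ⟨a⟩ ⟨b⟩; exact P.inf_le_left a b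
  inf_le_right := by rintro ⟨a⟩ ⟨b⟩; exact P.inf_le_right a b
  le_inf := by rintro ⟨a⟩ ⟨b⟩ ⟨c⟩ h h'; exact P.le_inf h h'
  bot := P.toCarrier P.bot
  bot_le := by rintro ⟨a⟩; exact P.bot_le a
  top := P.toCarrier P.top
  le_top := by rintro ⟨a⟩; exact P.le_top a
  sdiff_le_iff := by rintro ⟨a⟩ ⟨b⟩ ⟨c⟩; exact P.sdiff_le_iff a b c
  hnot := Quotient.map (P.sdiff P.top) fun _ _ h =>
    ⟨P.sdiff_mono (P.refl _) h.2, P.sdiff_mono (P.refl _) h.1⟩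
  top_sdiff := by rintro ⟨a⟩; rfl

end PreCoheyting

/-! ### The quotient by an ideal -/

section IdealQuotient

variable {L : Type u} [CoheytingAlgebra L] (I : Ideal L)

/-- The operations of `L` with the preorder `a \ b ∈ I`. -/
def idealPreCoheyting : PreCoheyting L where
  le a b := a \ b ∈ I
  sup := (· ⊔ ·)
  inf := (· ⊓ ·)
  sdiff := (· \ ·)
  bot := ⊥
  top := ⊤
  refl a := by rw [sdiff_self]; exact I.bot_mem
  trans {a b c} h h' := I.lower (sdiff_triangle a b c) (Ideal.sup_mem h h')
  le_sup_left a b := by rw [sdiff_eq_bot_iff.2 le_sup_left]; exact I.bot_mem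
  le_sup_right a b := by rw [sdiff_eq_bot_iff.2 le_sup_right]; exact I.bot_mem
  sup_le {a b c} h h' := by rw [sup_sdiff]; exact Ideal.sup_mem h h'
  inf_le_left a b := by rw [sdiff_eq_bot_iff.2 inf_le_left]; exact I.bot_mem
  inf_le_right a b := by rw [sdiff_eq_bot_iff.2 inf_le_right]; exact I.bot_mem
  le_inf {a b c} h h' := by rw [sdiff_inf]; exact Ideal.sup_mem h h'
  bot_le a := by rw [bot_sdiff]; exact I.bot_mem
  le_top a := by rw [sdiff_top]; exact I.bot_mem
  sdiff_le_iff a b c := by rw [sdiff_sdiff_left]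

/-- The co-Heyting algebra `L / I`. -/
abbrev IdealQuotient : Type u := (idealPreCoheyting I).Carrier

/-- The projection of `L` onto `L / I`. -/
def idealProj : CoheytingHom L (IdealQuotient I) where
  toFun := (idealPreCoheyting I).toCarrier
  map_sup' _ _ := rfl
  map_inf' _ _ := rfl
  map_top' := rfl
  map_sdiff' _ _ := rfl

theorem idealProj_surjective : Function.Surjective (idealProj I) :=
  (idealPreCoheyting I).toCarrier_surjective

theorem idealProj_eq_iff {a b : L} : idealProj I a = idealProj I b ↔ symmDiff a b ∈ I := by
  rw [le_antisymm_iff]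
  exact (Ideal.sup_mem_iff (I := I) (x := a \ b) (y := b \ a)).symm

theorem idealProj_eq_bot_iff {a : L} : idealProj I a = ⊥ ↔ a ∈ I := by
  rw [← map_bot (idealProj I), idealProj_eq_iff, symmDiff_bot]

theorem finite_idealQuotient [Finite (Quotient (idealSetoid I))] : Finite (IdealQuotient I) :=
  Finite.of_surjective
    (Quotient.lift (s := idealSetoid I) (idealProj I) fun _ _ h => (idealProj_eq_iff I).2 h)
    fun b => (idealProj_surjective I b).elim fun a ha => ⟨Quotient.mk _ a, ha⟩

end IdealQuotient

/-- An element with nonzero image in a finite algebra is avoided by the kernel of the morphism. -/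
theorem exists_ideal_of_map_ne_bot {L A : Type u} [CoheytingAlgebra L] [CoheytingAlgebra A]
    [Finite A] (φ : CoheytingHom L A) {a : L} (ha : φ a ≠ ⊥) :
    ∃ I : Ideal L, a ∉ I ∧ Finite (Quotient (idealSetoid I)) := by
  let I : Ideal L :=
    { carrier := {x | φ x = ⊥}
      lower' := fun x y hyx hx => le_bot_iff.1 ((OrderHomClass.mono φ hyx).trans_eq hx)
      nonempty' := ⟨⊥, map_bot φ⟩
      directed' := fun x hx y hy => ⟨x ⊔ y, by
        change φ (x ⊔ y) = ⊥
        rw [map_sup, show φ x = ⊥ from hx, show φ y = ⊥ from hy, sup_bot_eq],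
        le_sup_left, le_sup_right⟩ }
  have hI : ∀ x y, symmDiff x y ∈ I ↔ φ x = φ y := fun x y => by
    rw [show symmDiff x y ∈ I ↔ φ (symmDiff x y) = ⊥ from Iff.rfl, map_symmDiff, symmDiff_eq_bot]
  refine ⟨I, ha, Finite.of_injective (Quotient.lift φ fun x y h => (hI x y).1 h) ?_⟩
  rintro ⟨x⟩ ⟨y⟩ h
  exact Quotient.sound ((hI x y).2 h)

/-! ### Varieties and presentations -/

section Varieties

variable {V : AlgebraClass.{u}}

theorem IsVariety.of_surjective (hV : IsVariety V) {L M : Type u} [CoheytingAlgebra L]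
    [CoheytingAlgebra M] (φ : CoheytingHom L M) (hφ : Function.Surjective φ) (hL : V L) : V M := by
  obtain ⟨E, hE⟩ := hV
  refine (hE M).2 fun e he a => ?_
  choose s hs using hφ
  have h := congrArg φ ((hE L).1 hL e he fun i => s (a i))
  simpa only [Term.map_eval, hs] using h

theorem IsVariety.of_injective (hV : IsVariety V) {L M : Type u} [CoheytingAlgebra L]
    [CoheytingAlgebra M] (φ : CoheytingHom M L) (hφ : Function.Injective φ) (hL : V L) : V M := by
  obtain ⟨E, hE⟩ := hV
  refine (hE M).2 fun e he a => hφ ?_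
  rw [Term.map_eval, Term.map_eval]
  exact (hE L).1 hL e he _

/-- The subalgebra generated by `g`, as the set of the values of terms at `g`. -/
def Generated {X : Type v} {L : Type u} [CoheytingAlgebra L] (g : X → L) : Type u :=
  {a : L // ∃ t : Term X, t.eval g = a}

namespace Generated

variable {X : Type v} {L : Type u} [CoheytingAlgebra L] (g : X → L)

instance : CoheytingAlgebra (Generated g) where
  le a b := a.1 ≤ b.1
  le_refl a := le_refl a.1
  le_trans _ _ _ h h' := le_trans h h'
  le_antisymm _ _ h h' := Subtype.ext (le_antisymm h h')
  sup a b := ⟨a.1 ⊔ b.1, by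
    obtain ⟨_, s, rfl⟩ := a; obtain ⟨_, t, rfl⟩ := b; exact ⟨.sup s t, rfl⟩⟩
  inf a b := ⟨a.1 ⊓ b.1, by
    obtain ⟨_, s, rfl⟩ := a; obtain ⟨_, t, rfl⟩ := b; exact ⟨.inf s t, rfl⟩⟩
  sdiff a b := ⟨a.1 \ b.1, by
    obtain ⟨_, s, rfl⟩ := a; obtain ⟨_, t, rfl⟩ := b; exact ⟨.sub s t, rfl⟩⟩
  le_sup_left a b := le_sup_left (a := a.1) (b := b.1)
  le_sup_right a b := le_sup_right (a := a.1) (b := b.1)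
  sup_le _ _ _ h h' := sup_le (α := L) h h'
  inf_le_left a b := inf_le_left (a := a.1) (b := b.1)
  inf_le_right a b := inf_le_right (a := a.1) (b := b.1)
  le_inf _ _ _ h h' := le_inf (α := L) h h'
  bot := ⟨⊥, .zero, rfl⟩
  bot_le a := bot_le (a := a.1)
  top := ⟨⊤, .one, rfl⟩
  le_top a := le_top (a := a.1)
  sdiff_le_iff a b c := sdiff_le_iff (a := a.1) (b := b.1) (c := c.1)
  hnot a := ⟨⊤ \ a.1, by obtain ⟨_, s, rfl⟩ := a; exact ⟨.sub .one s, rfl⟩⟩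
  top_sdiff _ := rfl

/-- The inclusion of the subalgebra generated by `g`. -/
def incl : CoheytingHom (Generated g) L where
  toFun a := a.1
  map_sup' _ _ := rfl
  map_inf' _ _ := rfl
  map_top' := rfl
  map_sdiff' _ _ := rfl

theorem incl_injective : Function.Injective (incl g) := Subtype.val_injective

end Generated

/-- By the universal property, the identity of `L` factors through the subalgebra generated by the
generators of the presentation. -/
theorem IsPresentedBy.isGeneratedBy (hV : IsVariety V) {X : Type v} {R : Set (Term X × Term X)}
    {L : Type u} [CoheytingAlgebra L] {g : X → L} (h : IsPresentedBy V R L g) :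
    IsGeneratedBy g := by
  let f : X → Generated g := fun x => ⟨g x, .var x, rfl⟩
  have hf : ∀ x, Generated.incl g (f x) = g x := fun _ => rfl
  obtain ⟨φ, hφ, -⟩ := h.universal (Generated g)
    (hV.of_injective _ (Generated.incl_injective g) h.mem) f fun e he =>
      Generated.incl_injective g <| by
        simpa only [Term.map_eval, hf] using h.rel e he
  have hid : (Generated.incl g).comp φ = CoheytingHom.id L :=
    (h.universal L h.mem g h.rel).unique
      (fun x => by rw [CoheytingHom.comp_apply, hφ, hf]) (fun _ => rfl)
  intro a
  have ha : Generated.incl g (φ a) = a := DFunLike.congr_fun hid a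
  exact ha ▸ (φ a).2

theorem IsPresentedBy.reindex {X : Type v} {Y : Type*} {L : Type u} [CoheytingAlgebra L]
    {g : X → L} (h : IsPresentedBy V ∅ L g) (e : Y ≃ X) : IsPresentedBy V ∅ L (g ∘ e) where
  mem := h.mem
  rel _ he := he.elim
  universal A _ hA f _ := by
    obtain ⟨φ, hφ, huniq⟩ := h.universal A hA (f ∘ e.symm) fun _ he => he.elim
    refine ⟨φ, fun y => by simp [hφ], fun ψ hψ => huniq ψ fun x => ?_⟩
    simpa using hψ (e.symm x)

end Varieties

/-! ### Free algebras -/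

section Free

variable (V : AlgebraClass.{u}) (X : Type u)

/-- The terms over `X`, with `s` below `t` when the inequality `s ≤ t` holds throughout `V`. -/
def freePreCoheyting : PreCoheyting (Term X) where
  le s t := ∀ (A : Type u) [CoheytingAlgebra A], V A → ∀ f : X → A, s.eval f ≤ t.eval f
  sup := .sup
  inf := .inf
  sdiff := .sub
  bot := .zero
  top := .one
  refl _ _ _ _ _ := le_rfl
  trans h h' A _ hA f := (h A hA f).trans (h' A hA f)
  le_sup_left _ _ _ _ _ _ := le_sup_left
  le_sup_right _ _ _ _ _ _ := le_sup_right
  sup_le h h' A _ hA f := sup_le (h A hA f) (h' A hA f)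
  inf_le_left _ _ _ _ _ _ := inf_le_left
  inf_le_right _ _ _ _ _ _ := inf_le_right
  le_inf h h' A _ hA f := le_inf (h A hA f) (h' A hA f)
  bot_le _ _ _ _ _ := bot_le
  le_top _ _ _ _ _ := le_top
  sdiff_le_iff _ _ _ := forall₄_congr fun _ _ _ _ => sdiff_le_iff

/-- The free algebra of `V` on `X`: terms modulo the identities that hold in `V`. -/
abbrev FreeAlgebraIn : Type u := (freePreCoheyting V X).Carrier

variable {V X}

theorem eval_toCarrier {Y : Type*} (σ : Y → Term X) (t : Term Y) :
    t.eval (fun y => (freePreCoheyting V X).toCarrier (σ y)) =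
      (freePreCoheyting V X).toCarrier (t.subst σ) := by
  induction t with
  | var x => rfl
  | zero => rfl
  | one => rfl
  | sup s t hs ht => exact congrArg₂ (· ⊔ ·) hs ht
  | inf s t hs ht => exact congrArg₂ (· ⊓ ·) hs ht
  | sub s t hs ht => exact congrArg₂ (· \ ·) hs ht

theorem subst_var (t : Term X) : t.subst Term.var = t := by
  induction t <;> simp_all [Term.subst]

/-- The extension of a map from the generators to an algebra of `V`. -/
def freeLift {A : Type u} [CoheytingAlgebra A] (hA : V A) (f : X → A) :
    CoheytingHom (FreeAlgebraIn V X) A where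
  toFun := Quotient.lift (fun t : Term X => t.eval f)
    fun _ _ h => le_antisymm (h.1 A hA f) (h.2 A hA f)
  map_sup' := by rintro ⟨s⟩ ⟨t⟩; rfl
  map_inf' := by rintro ⟨s⟩ ⟨t⟩; rfl
  map_top' := show Term.one.eval f = ⊤ from rfl
  map_sdiff' := by rintro ⟨s⟩ ⟨t⟩; rfl

theorem freeAlgebraIn_isPresentedBy (hV : IsVariety V) (X : Type u) :
    IsPresentedBy V ∅ (FreeAlgebraIn V X)
      fun x => (freePreCoheyting V X).toCarrier (Term.var x) where
  mem := by
    obtain ⟨E, hE⟩ := hV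
    refine (hE _).2 fun e he a => ?_
    choose σ hσ using fun i => (freePreCoheyting V X).toCarrier_surjective (a i)
    obtain rfl : (fun i => (freePreCoheyting V X).toCarrier (σ i)) = a := funext hσ
    have key : ∀ (A : Type u) [CoheytingAlgebra A], V A → ∀ f : X → A,
        (e.1.subst σ).eval f = (e.2.subst σ).eval f := fun A _ hA f => by
      rw [Term.eval_subst, Term.eval_subst]
      exact (hE A).1 hA e he _
    rw [eval_toCarrier, eval_toCarrier]
    exact Quotient.sound ⟨fun A _ hA f => (key A hA f).le, fun A _ hA f => (key A hA f).ge⟩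
  rel _ he := he.elim
  universal A _ hA f _ := by
    refine ⟨freeLift hA f, fun _ => rfl, fun ψ hψ => CoheytingHom.ext fun a => ?_⟩
    obtain ⟨t, rfl⟩ := (freePreCoheyting V X).toCarrier_surjective a
    rw [← subst_var t, ← eval_toCarrier, Term.map_eval, Term.map_eval]
    exact congrArg (fun h => Term.eval h t) (funext hψ)

end Free

/-! ### The finite model property -/

section FiniteModelProperty

variable {V : AlgebraClass.{u}}

theorem isResiduallyFinite_of_isPresentedBy (hV : IsVariety V) (hfmp : HasFiniteModelProperty V)
    {X : Type v} {R : Set (Term X × Term X)} (hR : R.Finite) {L : Type u} [CoheytingAlgebra L]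
    {g : X → L} (h : IsPresentedBy V R L g) : IsResiduallyFinite L := by
  intro a ha
  obtain ⟨t, rfl⟩ := h.isGeneratedBy hV a
  obtain ⟨r, hr⟩ := Term.exists_of_finite_relations.{u} hR
  obtain ⟨ρ, hρ⟩ := Set.countable_iff_exists_injOn.1 (Term.finite_vars (.sub t r)).countable
  obtain ⟨y, hy⟩ := Term.exists_eval_subst_var_eq hρ g
  have hne : ((Term.sub t r).subst fun x => .var (ρ x)).eval y ≠ ⊥ := by
    rwa [hy, Term.eval, (hr L g).1 h.rel, sdiff_bot]
  obtain ⟨A, _, hA, _, z, hz⟩ := hfmp _ ⟨L, _, h.mem, y, hne⟩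
  rw [Term.eval_subst] at hz
  let f : X → A := fun x => z (ρ x)
  have htr : ¬ t.eval f ≤ r.eval f := fun hle => hz (sdiff_eq_bot_iff.2 hle)
  let I : Ideal A := Ideal.principal (r.eval f)
  let π := idealProj I
  have : Finite (IdealQuotient I) := Finite.of_surjective _ (idealProj_surjective I)
  obtain ⟨φ, hφ, -⟩ := h.universal (IdealQuotient I)
    (hV.of_surjective π (idealProj_surjective I) hA) (fun x => π (f x)) fun e he => by
      rw [← Term.map_eval, ← Term.map_eval]
      exact (idealProj_eq_iff I).2 ((hr A f).2 e he)
  refine exists_ideal_of_map_ne_bot φ ?_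
  simp only [Term.map_eval, hφ]
  rw [← Term.map_eval, Ne, idealProj_eq_bot_iff]
  exact htr

theorem hasFiniteModelProperty_of_free (hV : IsVariety V)
    (H : ∀ n : ℕ, ∃ (L : Type u) (_ : CoheytingAlgebra L) (g : Fin n → L),
      IsPresentedBy V ∅ L g ∧ IsHausdorff L) : HasFiniteModelProperty V := by
  rintro t ⟨A, _, hA, a, ha⟩
  obtain ⟨N, hN⟩ := t.finite_vars.bddAbove
  obtain ⟨L, _, g, hg, hL⟩ := H (N + 1)
  -- Only the variables up to `N` occur in `t`; the others may be given any value.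
  let b : ℕ → L := fun i => g (Fin.ofNat (N + 1) i)
  have hb : t.eval b ≠ ⊥ := by
    intro h0
    obtain ⟨φ, hφ, -⟩ := hg.universal A hA (fun i => a i) fun _ he => he.elim
    refine ha ?_
    rw [← map_bot φ, ← h0, Term.map_eval]
    refine Term.eval_congr fun i hi => ?_
    rw [hφ, Fin.val_ofNat, Nat.mod_eq_of_lt (Nat.lt_succ_of_le (hN hi))]
  obtain ⟨m, hm⟩ := (isHausdorff_iff L).1 hL _ hb
  have := (hg.isGeneratedBy hV).isPrecompact (m + 1)
  let I := codimIdeal L (m + 1)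
  refine ⟨IdealQuotient I, inferInstance,
    hV.of_surjective (idealProj I) (idealProj_surjective I) hg.mem, finite_idealQuotient I,
    fun i => idealProj I (b i), ?_⟩
  rw [← Term.map_eval, Ne, idealProj_eq_bot_iff]
  intro hmem
  have hle : (((m + 1 : ℕ) : Ordinal.{u}) : WithTop Ordinal.{u}) ≤ codim (t.eval b) := hmem
  rw [hm, WithTop.coe_le_coe, Nat.cast_le] at hle
  omega

end FiniteModelProperty

end CoHeyting

open CoHeyting in
theorem mainTheorem3 (V : CoHeyting.AlgebraClass.{u}) (hV : CoHeyting.IsVariety V) :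
    List.TFAE [
      CoHeyting.HasFiniteModelProperty V,
      ∀ (L : Type u) [CoheytingAlgebra L], CoHeyting.IsFreeIn V L →
        CoHeyting.IsResiduallyFinite L,
      ∀ (L : Type u) [CoheytingAlgebra L], CoHeyting.IsFreeIn V L →
        CoHeyting.IsHausdorff L,
      ∀ (L : Type u) [CoheytingAlgebra L], CoHeyting.IsFinitelyPresentedIn V L →
        CoHeyting.IsPrecompact L ∧ CoHeyting.IsHausdorff L] := by
  have hfree : ∀ n : ℕ, ∃ (L : Type u) (_ : CoheytingAlgebra L) (g : Fin n → L),
      IsPresentedBy V ∅ L g := fun n =>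
    ⟨_, _, _, (freeAlgebraIn_isPresentedBy hV (ULift.{u} (Fin n))).reindex Equiv.ulift.symm⟩
  tfae_have 1 → 2 := fun h L _ ⟨_, _, hg⟩ =>
    isResiduallyFinite_of_isPresentedBy hV h Set.finite_empty hg
  tfae_have 2 → 3 := fun h L _ hL => (h L hL).isHausdorff
  tfae_have 3 → 1 := fun h => hasFiniteModelProperty_of_free hV fun n => by
    obtain ⟨L, _, g, hg⟩ := hfree n
    exact ⟨L, _, g, hg, h L ⟨_, _, hg.reindex Equiv.ulift.{u}⟩⟩
  tfae_have 1 → 4 := fun h L _ ⟨_, _, _, hR, hg⟩ =>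
    ⟨(hg.isGeneratedBy hV).isPrecompact,
      (isResiduallyFinite_of_isPresentedBy hV h hR hg).isHausdorff⟩
  tfae_have 4 → 1 := fun h => hasFiniteModelProperty_of_free hV fun n => by
    obtain ⟨L, _, g, hg⟩ := hfree n
    exact ⟨L, _, g, hg, (h L ⟨n, ∅, g, Set.finite_empty, hg⟩).2⟩
  tfae_finish
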